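/- Let $X \neq \{0\}$ be a real Banach space with closed unit ball $B_X$ and unit sphere $S_X$. A *slice* of $B_X$ is a set $\{x \in B_X : x^*(x) > 1-\varepsilon\}$ with $x^* \in X^*$, $\|x^*\| = 1$ and $\varepsilon > 0$. Suppose that $X$ has the *strong diameter 2 property* (SD2P): for all $n \ge 1$, all slices $S_1,\dots,S_n$ of $B_X$ and all $\lambda_1,\dots,\lambda_n \ge 0$ with $\sum_{i=1}^n \lambda_i = 1$, the set $\sum_{i=1}^n \lambda_i S_i = \{\sum_{i=1}^n \lambda_i x_i : x_i \in S_i\}$ has diameter $2$. Then the bidual $X^{**}$ is neither strictly convex nor smooth. Here a Banach space $E$ is *strictly convex* if $\|\frac{x+y}{2}\| < 1$ for all $x \neq y$ in $S_E$, and *smooth* if for every $x \in S_E$ there is exactly one $f \in S_{E^*}$ with $f(x) = 1$. -/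

import Mathlib

/-- The slice `S(f, ε) = {x ∈ B_X : f x > 1 - ε}` of the closed unit ball of a real normed space
(used only for `‖f‖ = 1` and `ε > 0`). -/
def ballSlice {X : Type*} [NormedAddCommGroup X] [NormedSpace ℝ X]
    (f : StrongDual ℝ X) (ε : ℝ) : Set X :=
  {x | x ∈ Metric.closedBall (0 : X) 1 ∧ 1 - ε < f x}

/-- The strong diameter 2 property: every finite convex combination
`∑ i, c i • S (f i, ε i)` (elementwise sum of sets) of slices of the unit ball has diameter 2. -/
def StrongDiameterTwo (X : Type*) [NormedAddCommGroup X] [NormedSpace ℝ X] : Prop :=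
  ∀ (n : ℕ) (f : Fin n → StrongDual ℝ X) (ε c : Fin n → ℝ),
    (∀ i, ‖f i‖ = 1) → (∀ i, 0 < ε i) → (∀ i, 0 ≤ c i) → ∑ i, c i = 1 →
      Metric.diam {z : X | ∃ x : Fin n → X,
        (∀ i, x i ∈ ballSlice (f i) (ε i)) ∧ z = ∑ i, c i • x i} = 2

/-- The norm of `E` is smooth: every point of the unit sphere has exactly one norm-one
supporting functional. -/
def SmoothNorm (E : Type*) [NormedAddCommGroup E] [NormedSpace ℝ E] : Prop :=
  ∀ x : E, ‖x‖ = 1 → ∃! f : StrongDual ℝ E, ‖f‖ = 1 ∧ f x = 1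

/-
A norming functional for a far apart pair of points in an average of slices of `B_X` is close to `1`
somewhere on each of the slices, so the dual of a space with the strong diameter 2 property is
octahedral. In an octahedral space one picks unit vectors `y₀, y₁, …` such that all signed sums
`±y₀ ± ⋯ ± yₙ₋₁` have norm at least `n - 1`. As this deficit does not grow with `n`, a weak-*
compactness argument provides, for any signs `σ`, a functional of norm at most one whose values at
`σ n • y n` tend to `1`. The functionals `φ` and `ψ` for the constant and the alternating signs
satisfy `‖φ‖ = ‖ψ‖ = 1` and `‖φ + ψ‖ = ‖φ - ψ‖ = 2`, which no strictly convex and no smooth norm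
allows.
-/

open Filter Finset Topology

section NormedSpace

variable {E : Type*} [NormedAddCommGroup E] [NormedSpace ℝ E]

lemma apply_le_norm_of_norm_le_one (f : StrongDual ℝ E) {x : E} (hx : ‖x‖ ≤ 1) : f x ≤ ‖f‖ :=
  (Real.le_norm_self _).trans (f.unit_le_opNorm x hx)

lemma exists_lt_dist_of_lt_diam {α : Type*} [PseudoMetricSpace α] {s : Set α} {r : ℝ}
    (hr : 0 ≤ r) (hrs : r < Metric.diam s) : ∃ x ∈ s, ∃ y ∈ s, r < dist x y := by
  by_contra! h
  exact hrs.not_ge (Metric.diam_le_of_forall_dist_le hr h)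

lemma exists_ballSlice_forall_norm_sub_le_apply [Nontrivial E] (g : StrongDual ℝ E) {δ : ℝ}
    (hδ : 0 < δ) :
    ∃ (u : StrongDual ℝ E) (ε : ℝ), ‖u‖ = 1 ∧ 0 < ε ∧ ∀ x ∈ ballSlice u ε, ‖g‖ - δ ≤ g x := by
  rcases eq_or_ne g 0 with rfl | hg
  · obtain ⟨u, hu⟩ := exists_norm_eq (StrongDual ℝ E) zero_le_one
    exact ⟨u, 1, hu, one_pos, fun x _ => by simpa using hδ.le⟩
  · have hg' : 0 < ‖g‖ := norm_pos_iff.2 hg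
    refine ⟨‖g‖⁻¹ • g, δ / ‖g‖, norm_smul_inv_norm hg, by positivity, fun x hx => ?_⟩
    have hgx : 1 - δ / ‖g‖ < g x / ‖g‖ := by simpa [div_eq_inv_mul] using hx.2
    rw [one_sub_div hg'.ne', div_lt_div_iff_of_pos_right hg'] at hgx
    exact hgx.le

/-- Octahedrality of the norm of `E`, which by homogeneity and compactness of the spheres of
finite-dimensional subspaces is equivalent to the usual definition: for every finite-dimensional
subspace `F` and `ε > 0` there is a unit vector `y` with `‖x + y‖ ≥ (1 - ε) (‖x‖ + 1)` on `F`. -/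
def OctahedralNorm (E : Type*) [NormedAddCommGroup E] [NormedSpace ℝ E] : Prop :=
  ∀ (s : Finset E) (ε : ℝ), 0 < ε → ∃ y : E, ‖y‖ = 1 ∧ ∀ x ∈ s, ‖x‖ + 1 - ε ≤ ‖x + y‖

lemma StrongDiameterTwo.exists_norm_eq_one_forall_exists_lt_apply [Nontrivial E]
    (hE : StrongDiameterTwo E) {n : ℕ} {u : Fin n → StrongDual ℝ E} {ε : Fin n → ℝ}
    (hu : ∀ i, ‖u i‖ = 1) (hε : ∀ i, 0 < ε i) {η : ℝ} (hη : 0 < η) :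
    ∃ f : StrongDual ℝ E, ‖f‖ = 1 ∧ ∀ i, ∃ x ∈ ballSlice (u i) (ε i), 1 - η < f x := by
  obtain rfl | hn := n.eq_zero_or_pos
  · obtain ⟨f, hf⟩ := exists_norm_eq (StrongDual ℝ E) zero_le_one
    exact ⟨f, hf, fun i => i.elim0⟩
  have hn' : (0 : ℝ) < n := by exact_mod_cast hn
  have hηn : 0 < η / n := by positivity
  have hdiam := hE n u ε (fun _ => (n : ℝ)⁻¹) hu hε (fun _ => by positivity)
    (by simp [hn'.ne'])
  obtain ⟨_, ⟨x, hx, rfl⟩, _, ⟨y, hy, rfl⟩, hxy⟩ := exists_lt_dist_of_lt_diam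
    (le_max_left 0 (2 - η / n)) (hdiam.symm ▸ max_lt two_pos (by linarith))
  rw [dist_eq_norm, ← smul_sum, ← smul_sum, ← smul_sub, ← sum_sub_distrib] at hxy
  obtain ⟨f, hf, hfxy⟩ := exists_dual_vector' ℝ ((n : ℝ)⁻¹ • ∑ i, (x i - y i))
  have hle (z : E) (hz : ‖z‖ ≤ 1) : f z ≤ 1 := hf ▸ apply_le_norm_of_norm_le_one f hz
  have hfx (i : Fin n) : f (x i) ≤ 1 := hle _ (by simpa using (hx i).1)
  have hfy (i : Fin n) : -f (y i) ≤ 1 := by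
    simpa using hle (-y i) (by simpa using (hy i).1)
  have hsum : 2 * n - η < ∑ i, (f (x i) - f (y i)) := by
    have h : 2 - η / n < (n : ℝ)⁻¹ * ∑ i, (f (x i) - f (y i)) := by
      simpa using (le_max_right _ _).trans_lt (hxy.trans_eq hfxy.symm)
    calc 2 * n - η = n * (2 - η / n) := by field_simp
      _ < n * ((n : ℝ)⁻¹ * ∑ i, (f (x i) - f (y i))) := by gcongr
      _ = ∑ i, (f (x i) - f (y i)) := mul_inv_cancel_left₀ hn'.ne' _
  refine ⟨f, hf, fun i => ⟨x i, hx i, ?_⟩⟩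
  have hi : 2 - (f (x i) - f (y i)) ≤ ∑ j, (2 - (f (x j) - f (y j))) :=
    single_le_sum (f := fun j => 2 - (f (x j) - f (y j)))
      (fun j _ => by linarith [hfx j, hfy j]) (mem_univ i)
  have hdefect : ∑ j, (2 - (f (x j) - f (y j))) = 2 * n - ∑ j, (f (x j) - f (y j)) := by
    simp [mul_comm]
  linarith [hfy i]

lemma StrongDiameterTwo.octahedralNorm_strongDual [Nontrivial E] (hE : StrongDiameterTwo E) :
    OctahedralNorm (StrongDual ℝ E) := by
  intro s δ hδ
  choose u ε hu hε hslice using fun g : StrongDual ℝ E =>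
    exists_ballSlice_forall_norm_sub_le_apply g (half_pos hδ)
  let g : Fin #s → StrongDual ℝ E := fun i => s.equivFin.symm i
  obtain ⟨f, hf, hfslice⟩ := hE.exists_norm_eq_one_forall_exists_lt_apply
    (fun i => hu (g i)) (fun i => hε (g i)) (half_pos hδ)
  refine ⟨f, hf, fun h hs => ?_⟩
  obtain ⟨i, rfl⟩ : ∃ i, g i = h := ⟨s.equivFin ⟨h, hs⟩, by simp [g]⟩
  obtain ⟨x, hx, hfx⟩ := hfslice i
  calc ‖g i‖ + 1 - δ ≤ (g i + f) x := by
        rw [add_apply]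
        linarith [hslice (g i) x hx]
    _ ≤ ‖g i + f‖ := apply_le_norm_of_norm_le_one _ (by simpa using hx.1)

lemma OctahedralNorm.exists_forall_le_norm_add_smul (hE : OctahedralNorm E) (s : Finset E) {ε : ℝ}
    (hε : 0 < ε) :
    ∃ y : E, ‖y‖ = 1 ∧ ∀ x ∈ s, ∀ c : ℝ, |c| = 1 → ‖x‖ + 1 - ε ≤ ‖x + c • y‖ := by
  classical
  obtain ⟨y, hy, hys⟩ := hE (s ∪ s.image Neg.neg) ε hε
  refine ⟨y, hy, fun x hx c hc => ?_⟩
  obtain rfl | rfl := eq_or_eq_neg_of_abs_eq hc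
  · simpa using hys x (mem_union_left _ hx)
  · have h := hys (-x) (mem_union_right _ (mem_image_of_mem _ hx))
    rwa [norm_neg, ← norm_neg (-x + y), neg_add, neg_neg, ← neg_one_smul ℝ y] at h

lemma OctahedralNorm.exists_seq_le_norm_sum (hE : OctahedralNorm E) :
    ∃ y : ℕ → E, (∀ n, ‖y n‖ = 1) ∧ ∀ σ : ℕ → ℝ, (∀ i, |σ i| = 1) →
      ∀ n : ℕ, n - 1 ≤ ‖∑ i ∈ range n, σ i • y i‖ := by
  classical
  have hε (n : ℕ) : (0 : ℝ) < (1 / 2) ^ (n + 1) := by positivity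
  choose Y hY hYs using fun n s => hE.exists_forall_le_norm_add_smul s (hε n)
  -- `s n` contains all signed sums of the first `n` vectors.
  let s : ℕ → Finset E := Nat.rec {0} fun n t => t.image (· + Y n t) ∪ t.image (· - Y n t)
  refine ⟨fun n => Y n (s n), fun n => hY _ _, fun σ hσ n => ?_⟩
  have hmem (n : ℕ) : ∑ i ∈ range n, σ i • Y i (s i) ∈ s n := by
    induction n with
    | zero => simp [s]
    | succ n ih =>
      rw [sum_range_succ]
      obtain h | h := eq_or_eq_neg_of_abs_eq (hσ n)
      · exact mem_union_left _ (mem_image.2 ⟨_, ih, by rw [h, one_smul]⟩)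
      · exact mem_union_right _ (mem_image.2 ⟨_, ih, by rw [h, neg_one_smul, sub_eq_add_neg]⟩)
  have hnorm (n : ℕ) : n - 1 + (1 / 2) ^ n ≤ ‖∑ i ∈ range n, σ i • Y i (s i)‖ := by
    induction n with
    | zero => simp
    | succ n ih =>
      have h := hYs n (s n) _ (hmem n) (σ n) (hσ n)
      rw [sum_range_succ]
      push_cast
      rw [pow_succ] at h ⊢
      linarith
  linarith [hnorm n, pow_pos (one_half_pos (α := ℝ)) n]

lemma exists_strongDual_forall_sum_one_sub_le {x : ℕ → E} {C : ℝ} (hx : ∀ i, ‖x i‖ ≤ 1)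
    (hsum : ∀ n : ℕ, n - C ≤ ‖∑ i ∈ range n, x i‖) :
    ∃ φ : StrongDual ℝ E, ‖φ‖ ≤ 1 ∧ ∀ n, ∑ i ∈ range n, (1 - φ (x i)) ≤ C := by
  let B : Set (WeakDual ℝ E) := WeakDual.toStrongDual ⁻¹' Metric.closedBall 0 1
  have hB : IsCompact B := WeakDual.isCompact_closedBall 0 1
  let K (n : ℕ) : Set (WeakDual ℝ E) := B ∩ {φ | ∑ i ∈ range n, (1 - φ (x i)) ≤ C}
  have hK (n : ℕ) : IsClosed {φ : WeakDual ℝ E | ∑ i ∈ range n, (1 - φ (x i)) ≤ C} :=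
    isClosed_le (continuous_finsetSum _ fun i _ =>
      continuous_const.sub (WeakDual.eval_continuous (x i))) continuous_const
  have hanti (n : ℕ) : K (n + 1) ⊆ K n := by
    rintro φ ⟨hφ, hs⟩
    have hφx : φ (x n) ≤ 1 :=
      (apply_le_norm_of_norm_le_one (WeakDual.toStrongDual φ) (hx n)).trans (by simpa [B] using hφ)
    refine ⟨hφ, ?_⟩
    simp only [Set.mem_ofPred_eq, sum_range_succ] at hs ⊢
    linarith
  have hne (n : ℕ) : (K n).Nonempty := by
    obtain ⟨φ, hφ, hφs⟩ := exists_dual_vector'' ℝ (∑ i ∈ range n, x i)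
    have hdefect : ∑ i ∈ range n, (1 - φ (x i)) = n - ‖∑ i ∈ range n, x i‖ := by
      simpa using hφs
    have hle : ∑ i ∈ range n, (1 - φ (x i)) ≤ C := by linarith [hsum n]
    exact ⟨StrongDual.toWeakDual φ, by simpa [B] using hφ, hle⟩
  obtain ⟨φ, hφ⟩ := IsCompact.nonempty_iInter_of_sequence_nonempty_isCompact_isClosed K hanti hne
    (hB.inter_right (hK 0)) fun n => hB.isClosed.inter (hK n)
  rw [Set.mem_iInter] at hφ
  exact ⟨WeakDual.toStrongDual φ, by simpa [B] using (hφ 0).1, fun n => (hφ n).2⟩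

lemma exists_strongDual_tendsto_one {x : ℕ → E} {C : ℝ} (hx : ∀ i, ‖x i‖ ≤ 1)
    (hsum : ∀ n : ℕ, n - C ≤ ‖∑ i ∈ range n, x i‖) :
    ∃ φ : StrongDual ℝ E, ‖φ‖ ≤ 1 ∧ Tendsto (fun i => φ (x i)) atTop (𝓝 1) := by
  obtain ⟨φ, hφ, hφC⟩ := exists_strongDual_forall_sum_one_sub_le hx hsum
  have hsummable : Summable fun i => 1 - φ (x i) := summable_of_sum_range_le
    (fun i => sub_nonneg.2 ((apply_le_norm_of_norm_le_one φ (hx i)).trans hφ)) hφC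
  exact ⟨φ, hφ, by simpa using hsummable.tendsto_atTop_zero.const_sub 1⟩

lemma OctahedralNorm.exists_strongDual_norm_add_sub (hE : OctahedralNorm E) :
    ∃ φ ψ : StrongDual ℝ E, ‖φ‖ = 1 ∧ ‖ψ‖ = 1 ∧ ‖φ + ψ‖ = 2 ∧ ‖φ - ψ‖ = 2 := by
  obtain ⟨y, hy, hysum⟩ := hE.exists_seq_le_norm_sum
  obtain ⟨φ, hφ, hφy⟩ := exists_strongDual_tendsto_one (fun i => (hy i).le)
    (by simpa using hysum (fun _ => 1) (by simp))
  obtain ⟨ψ, hψ, hψy⟩ := exists_strongDual_tendsto_one (x := fun i => (-1 : ℝ) ^ i • y i)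
    (fun i => by simp [norm_smul, hy]) (hysum _ (by simp))
  have hlim : Tendsto (fun n => φ (y n) + ψ ((-1 : ℝ) ^ n • y n)) atTop (𝓝 2) :=
    one_add_one_eq_two (R := ℝ) ▸ hφy.add hψy
  have hadd : 2 ≤ ‖φ + ψ‖ := le_of_tendsto_of_frequently hlim <|
    Nat.frequently_even.mono fun n hn => by
      simpa [hn.neg_one_pow] using apply_le_norm_of_norm_le_one (φ + ψ) (hy n).le
  have hsub : 2 ≤ ‖φ - ψ‖ := le_of_tendsto_of_frequently hlim <|
    Nat.frequently_odd.mono fun n hn => by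
      simpa [hn.neg_one_pow, ← sub_eq_add_neg] using
        apply_le_norm_of_norm_le_one (φ - ψ) (hy n).le
  have hadd' := norm_add_le φ ψ
  have hsub' := norm_sub_le φ ψ
  exact ⟨φ, ψ, by linarith, by linarith, by linarith, by linarith⟩

lemma not_strictConvexSpace_of_norm_add_sub {x y : E} (hx : ‖x‖ = 1) (hy : ‖y‖ = 1)
    (hadd : ‖x + y‖ = 2) (hsub : ‖x - y‖ = 2) : ¬ StrictConvexSpace ℝ E := by
  intro _
  have hxy : x = y :=
    eq_of_norm_eq_of_norm_add_eq (hx.trans hy.symm) (by rw [hx, hy, hadd]; norm_num)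
  simp [hxy] at hsub

lemma exists_strongDual_apply_eq_one_of_norm_add_eq_two {x y : E} (hx : ‖x‖ ≤ 1) (hy : ‖y‖ ≤ 1)
    (hxy : ‖x + y‖ = 2) : ∃ f : StrongDual ℝ E, ‖f‖ = 1 ∧ f x = 1 ∧ f y = 1 := by
  obtain ⟨f, hf, hfxy⟩ := exists_dual_vector ℝ (x + y) (by simp [hxy])
  have hsum : f x + f y = 2 := by simpa [hxy] using hfxy
  have hfx : f x ≤ 1 := hf ▸ apply_le_norm_of_norm_le_one f hx
  have hfy : f y ≤ 1 := hf ▸ apply_le_norm_of_norm_le_one f hy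
  exact ⟨f, hf, by linarith, by linarith⟩

lemma not_smoothNorm_of_norm_add_sub {x y : E} (hx : ‖x‖ = 1) (hy : ‖y‖ ≤ 1)
    (hadd : ‖x + y‖ = 2) (hsub : ‖x - y‖ = 2) : ¬ SmoothNorm E := by
  intro hE
  obtain ⟨f, hf, hfx, hfy⟩ := exists_strongDual_apply_eq_one_of_norm_add_eq_two hx.le hy hadd
  obtain ⟨g, hg, hgx, hgy⟩ := exists_strongDual_apply_eq_one_of_norm_add_eq_two hx.le
    ((norm_neg y).trans_le hy) (sub_eq_add_neg x y ▸ hsub)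
  have hfg : f = g := (hE x hx).unique ⟨hf, hfx⟩ ⟨hg, hgx⟩
  rw [map_neg, ← hfg, hfy] at hgy
  norm_num at hgy

end NormedSpace

theorem corollary2p5_general {X : Type*} [NormedAddCommGroup X] [NormedSpace ℝ X] [Nontrivial X]
    (hX : StrongDiameterTwo X) :
    ¬ StrictConvexSpace ℝ (StrongDual ℝ (StrongDual ℝ X)) ∧
      ¬ SmoothNorm (StrongDual ℝ (StrongDual ℝ X)) := by
  obtain ⟨φ, ψ, hφ, hψ, hadd, hsub⟩ :=
    hX.octahedralNorm_strongDual.exists_strongDual_norm_add_sub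
  exact ⟨not_strictConvexSpace_of_norm_add_sub hφ hψ hadd hsub,
    not_smoothNorm_of_norm_add_sub hφ hψ.le hadd hsub⟩

theorem corollary2p5 (X : Type*) [NormedAddCommGroup X] [NormedSpace ℝ X] [CompleteSpace X]
    [Nontrivial X] (hX : StrongDiameterTwo X) :
    ¬ StrictConvexSpace ℝ (StrongDual ℝ (StrongDual ℝ X)) ∧
      ¬ SmoothNorm (StrongDual ℝ (StrongDual ℝ X)) :=
  corollary2p5_general hX
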